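/- Let $\mathcal X\subset\mathbb R^{d_x}$ and $\mathcal Y\subset\mathbb R^{d_y}$ be measurable, $\Theta=\mathcal X\times\mathcal Y\subset\mathbb R^d$ with $d=d_x+d_y$, and let $\|\cdot\|_2$ be the Euclidean norm. For each sample size $n\ge1$ let $\{p^{(n)}_\theta:\theta\in\Theta\}$ be probability distributions of the data $X^{(n)}$ with densities, also written $p^{(n)}_\theta(\cdot)$ and jointly measurable in $(\theta,X^{(n)})$, with respect to a $\sigma$-finite measure. Let $\pi_0$ be a prior on $\Theta$ with Lebesgue density $\pi_0(\theta)$. Let $\theta_0\in\Theta$ be the true parameter, write $p^{(n)}_0=p^{(n)}_{\theta_0}$, and assume that $\Theta$ is not too thin at $\theta_0$: there is $c>0$ such that $\Theta\cap\{\|\theta-\theta_0\|_2<r\}$ has Lebesgue measure at least $c\,r^d$ for all $0<r\le1$ (for instance, $\theta_0$ is an interior point of $\Theta$, or $\Theta$ is convex with non-empty interior). The posterior is $\pi_n(d\theta)\propto p^{(n)}_\theta(X^{(n)})\,\pi_0(d\theta)$, and the mean-field variational posterior $q_n^*$ is any minimizer of $q\mapsto\mathrm{KL}(q\,\|\,\pi_n)$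 over the products $q=q_x\otimes q_y$ of a probability measure on $\mathcal X$ and one on $\mathcal Y$ (assumed to exist for $p_0^{(n)}$-almost every $X^{(n)}$). Let $\varepsilon_n>0$ with $\varepsilon_n\to0$ and $n\varepsilon_n^2\ge1$, and let $C_1,C_2,C$ be constants with $C>C_2+2$. Suppose that for every $n\ge1$ the following hold. (A1) For every $\varepsilon>\varepsilon_n$ there are a measurable set $\Theta_n(\varepsilon)\subset\Theta$ and a test $\phi_n=\phi_n(X^{(n)})\in[0,1]$ (which may depend on $\varepsilon$) with $$\mathbb E_{p_0^{(n)}}(\phi_n)\le e^{-Cn\varepsilon^2},\qquad \sup_{\theta\in\Theta_n(\varepsilon),\ \|\theta-\theta_0\|_2^2>C_1\varepsilon^2}\mathbb E_{p_\theta^{(n)}}(1-\phi_n)\le e^{-Cn\varepsilon^2}.$$ (A2) For every $\varepsilon>\varepsilon_n$, with the same sets, $\pi_0(\Theta_n(\varepsilon)^c)\le e^{-Cn\varepsilon^2}$; and, for some $\rho>1$ not depending on $n$, $\pi_0\big(\theta\in\Theta: D_\rho(p_0^{(n)}\|p_\theta^{(n)})\le C_2n\varepsilon_n^2\big)>0$,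 where $D_\rho(p\|q)=\frac1{\rho-1}\log\int(\frac{dp}{dq})^\rho dq$ is the Rényi divergence ($+\infty$ if $p\not\ll q$). (A3) $\pi_0(\theta)>0$ on $\Theta$ and $|\log\pi_0(\theta)-\log\pi_0(\theta')|\le C_3\|\theta-\theta'\|_2$ for all $\theta,\theta'\in\Theta$, for some $C_3>0$ not depending on $n$; and, for $p_0^{(n)}$-almost every $X^{(n)}$, $p^{(n)}_\theta(X^{(n)})>0$ for all $\theta\in\Theta$ and $$|\log p^{(n)}_\theta(X^{(n)})-\log p^{(n)}_{\theta'}(X^{(n)})|\le C_4(X^{(n)})\,\|\theta-\theta'\|_2\qquad\text{for all }\theta,\theta'\in\Theta,$$ where $C_{5,n}:=\mathbb E_{p_0^{(n)}}[C_4(X^{(n)})]<\infty$ and $n^{-3/2}C_{5,n}\to0$ as $n\to\infty$ (in particular $C_{5,n}$ may be bounded in $n$, or of order $n$). Then $q_n^*$ is consistent: whenever the data $X^{(1)},X^{(2)},\dots$ are defined on a common probability space with $X^{(n)}\sim p_0^{(n)}$ for each $n$, for every $\epsilon>0$, almost surely, $$q_n^*\big(\|\theta-\theta_0\|_2^2>\epsilon\big)\longrightarrow0\qquad\text{as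 }n\to\infty .$$ -/

import Mathlib

open MeasureTheory Filter Topology

noncomputable section

/-- The ambient space `ℝ^dx × ℝ^dy` of the two-block parameter `θ = (x, y)`. Its `volume` is
Lebesgue measure. (The norm Mathlib puts on a product is the sup norm, which is never used
below: distances are measured with `paramDist`.) -/
abbrev Param (dx dy : ℕ) : Type :=
  EuclideanSpace ℝ (Fin dx) × EuclideanSpace ℝ (Fin dy)

/-- The Euclidean distance `‖θ - θ'‖₂` on `ℝ^dx × ℝ^dy = ℝ^(dx + dy)`. -/
def paramDist {dx dy : ℕ} (θ θ' : Param dx dy) : ℝ :=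
  Real.sqrt (‖θ.1 - θ'.1‖ ^ 2 + ‖θ.2 - θ'.2‖ ^ 2)

/-- The `ρ`-Rényi divergence `D_ρ(P ‖ Q)` of two probability measures, with values in the extended
reals: `(ρ - 1)⁻¹ log ∫ (dP/dQ)^ρ dQ` for `ρ ≠ 1` (and `+∞` if `ρ > 1` and `P` is not absolutely
continuous with respect to `Q`), the Kullback-Leibler divergence for `ρ = 1`. -/
def renyiDiv {S : Type*} [MeasurableSpace S] (ρ : ℝ) (P Q : Measure S) : EReal :=
  open Classical in
  if ρ = 1 then ((InformationTheory.klDiv P Q : ENNReal) : EReal)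
  else if 1 < ρ ∧ ¬ P ≪ Q then ⊤
  else (((ρ - 1)⁻¹ : ℝ) : EReal) * ENNReal.log (∫⁻ x, (P.rnDeriv Q x) ^ ρ ∂Q)

/-- The mean-field family `𝒫(X) ⊗ 𝒫(Y)`: products of a probability measure on `X` and a
probability measure on `Y`. -/
def meanFieldFamily {dx dy : ℕ} (X : Set (EuclideanSpace ℝ (Fin dx)))
    (Y : Set (EuclideanSpace ℝ (Fin dy))) : Set (Measure (Param dx dy)) :=
  {q | ∃ (qx : Measure (EuclideanSpace ℝ (Fin dx))) (qy : Measure (EuclideanSpace ℝ (Fin dy))),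
    IsProbabilityMeasure qx ∧ IsProbabilityMeasure qy ∧ qx Xᶜ = 0 ∧ qy Yᶜ = 0 ∧ q = qx.prod qy}

/-- A Bayesian model with parameter set `Θ = X × Y ⊆ ℝ^dx × ℝ^dy`, a prior on `Θ` with a Lebesgue
density, and, for every sample size `n`, a statistical model for the data `X⁽ⁿ⁾ ∈ S n` with
densities `lik n θ` with respect to a σ-finite measure `base n`. Values of `priorDensity` and
`lik n` outside `Θ` play no role. -/
structure BayesModel (dx dy : ℕ) (S : ℕ → Type*) [∀ n, MeasurableSpace (S n)] where
  /-- first block of the parameter set -/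
  X : Set (EuclideanSpace ℝ (Fin dx))
  /-- second block of the parameter set -/
  Y : Set (EuclideanSpace ℝ (Fin dy))
  measurableSet_X : MeasurableSet X
  measurableSet_Y : MeasurableSet Y
  /-- Lebesgue density of the prior -/
  priorDensity : Param dx dy → ℝ
  measurable_priorDensity : Measurable priorDensity
  priorDensity_nonneg : ∀ θ ∈ X ×ˢ Y, 0 ≤ priorDensity θ
  lintegral_priorDensity : ∫⁻ θ in X ×ˢ Y, ENNReal.ofReal (priorDensity θ) = 1
  /-- dominating measure on the sample space -/
  base : ∀ n, Measure (S n)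
  sigmaFinite_base : ∀ n, SigmaFinite (base n)
  /-- the likelihood `lik n θ x = p_θ⁽ⁿ⁾(x)` -/
  lik : ∀ n, Param dx dy → S n → ℝ
  measurable_lik : ∀ n, Measurable (Function.uncurry (lik n))
  lik_nonneg : ∀ n, ∀ θ ∈ X ×ˢ Y, ∀ x, 0 ≤ lik n θ x
  lintegral_lik : ∀ n, ∀ θ ∈ X ×ˢ Y, ∫⁻ x, ENNReal.ofReal (lik n θ x) ∂(base n) = 1

namespace BayesModel

variable {dx dy : ℕ} {S : ℕ → Type*} [∀ n, MeasurableSpace (S n)]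

/-- The parameter set `Θ = X × Y`. -/
def paramSet (M : BayesModel dx dy S) : Set (Param dx dy) := M.X ×ˢ M.Y

/-- The prior distribution `π₀(dθ)`. -/
def prior (M : BayesModel dx dy S) : Measure (Param dx dy) :=
  (volume.restrict M.paramSet).withDensity (fun θ => ENNReal.ofReal (M.priorDensity θ))

/-- The distribution `p_θ⁽ⁿ⁾(dX⁽ⁿ⁾)` of the data under the parameter `θ`. -/
def dataLaw (M : BayesModel dx dy S) (n : ℕ) (θ : Param dx dy) : Measure (S n) :=
  (M.base n).withDensity (fun x => ENNReal.ofReal (M.lik n θ x))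

/-- The marginal likelihood `∫ p_θ⁽ⁿ⁾(x) π₀(dθ)`. -/
def evidence (M : BayesModel dx dy S) (n : ℕ) (x : S n) : ENNReal :=
  ∫⁻ θ, ENNReal.ofReal (M.lik n θ x) ∂M.prior

/-- The posterior distribution `π_n(dθ) ∝ p_θ⁽ⁿ⁾(x) π₀(dθ)` given the data `x`. -/
def posterior (M : BayesModel dx dy S) (n : ℕ) (x : S n) : Measure (Param dx dy) :=
  (M.evidence n x)⁻¹ • M.prior.withDensity (fun θ => ENNReal.ofReal (M.lik n θ x))

/-- `q` is a mean-field variational posterior given the data `x`: it belongs to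
`argmin {KL(q ‖ π_n) : q ∈ 𝒫(X) ⊗ 𝒫(Y)}`. -/
def IsVariationalPosterior (M : BayesModel dx dy S) (n : ℕ) (x : S n)
    (q : Measure (Param dx dy)) : Prop :=
  q ∈ meanFieldFamily M.X M.Y ∧
    ∀ q' ∈ meanFieldFamily M.X M.Y,
      InformationTheory.klDiv q (M.posterior n x) ≤ InformationTheory.klDiv q' (M.posterior n x)

/-- Testing condition for the true parameter `θ₀` with sets `Θ_n(ε) = sieve n ε` (the bound on the
supremum is stated pointwise in `θ`). -/
def TestingCondition (M : BayesModel dx dy S) (θ₀ : Param dx dy) (eps : ℕ → ℝ) (C₁ C : ℝ)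
    (sieve : ℕ → ℝ → Set (Param dx dy)) : Prop :=
  ∀ n : ℕ, 1 ≤ n → ∀ ε : ℝ, eps n < ε →
    MeasurableSet (sieve n ε) ∧ sieve n ε ⊆ M.paramSet ∧
    ∃ φ : S n → ℝ, Measurable φ ∧ (∀ x, φ x ∈ Set.Icc (0 : ℝ) 1) ∧
      ∫ x, φ x ∂(M.dataLaw n θ₀) ≤ Real.exp (-(C * n * ε ^ 2)) ∧
      ∀ θ ∈ sieve n ε, C₁ * ε ^ 2 < paramDist θ θ₀ ^ 2 →
        ∫ x, (1 - φ x) ∂(M.dataLaw n θ) ≤ Real.exp (-(C * n * ε ^ 2))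

/-- Prior mass conditions for the true parameter `θ₀`. -/
def PriorMassCondition (M : BayesModel dx dy S) (θ₀ : Param dx dy) (eps : ℕ → ℝ) (C₂ C : ℝ)
    (sieve : ℕ → ℝ → Set (Param dx dy)) : Prop :=
  (∀ n : ℕ, 1 ≤ n → ∀ ε : ℝ, eps n < ε →
    M.prior (sieve n ε)ᶜ ≤ ENNReal.ofReal (Real.exp (-(C * n * ε ^ 2)))) ∧
  ∃ ρ : ℝ, 1 < ρ ∧ ∀ n : ℕ, 1 ≤ n →
    0 < M.prior {θ | θ ∈ M.paramSet ∧
      renyiDiv ρ (M.dataLaw n θ₀) (M.dataLaw n θ) ≤ ((C₂ * n * eps n ^ 2 : ℝ) : EReal)}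

/-- Smoothness: the log-prior is Lipschitz on `Θ`, and so is the log-likelihood, with a
data-dependent constant `C₄ n x` whose expectation `C₅ₙ` under the true parameter is finite and is
`o(n^{3/2})` (in particular, it may be bounded, or of order `n` as for independent data).
Positivity of the densities makes the logarithms finite. -/
def SmoothnessCondition (M : BayesModel dx dy S) (θ₀ : Param dx dy) : Prop :=
  (∀ θ ∈ M.paramSet, 0 < M.priorDensity θ) ∧
  (∃ C₃ : ℝ, 0 < C₃ ∧ ∀ θ ∈ M.paramSet, ∀ θ' ∈ M.paramSet,
    |Real.log (M.priorDensity θ) - Real.log (M.priorDensity θ')| ≤ C₃ * paramDist θ θ') ∧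
  ∃ C₄ : ∀ n, S n → ℝ,
    (∀ n : ℕ, 1 ≤ n → ∀ᵐ x ∂(M.dataLaw n θ₀),
      (∀ θ ∈ M.paramSet, 0 < M.lik n θ x) ∧
      ∀ θ ∈ M.paramSet, ∀ θ' ∈ M.paramSet,
        |Real.log (M.lik n θ x) - Real.log (M.lik n θ' x)| ≤ C₄ n x * paramDist θ θ') ∧
    (∀ n : ℕ, 1 ≤ n → Integrable (C₄ n) (M.dataLaw n θ₀)) ∧
    Tendsto (fun n : ℕ => (∫ x, C₄ n x ∂(M.dataLaw n θ₀)) / (n : ℝ) ^ (3 / 2 : ℝ)) atTop (𝓝 0)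

end BayesModel

end

/-! The minimizer `q` is no further from the posterior `π` in KL than any other product measure. The
competitor is the uniform law on a product box of radius `n⁻⁴` around `θ₀`. On that box, prior
density times likelihood is at least a constant times `p₀`, by the Lipschitz bounds, while the
evidence is at most `n² p₀`. The competitor therefore has density at most polynomial in `n` with
respect to `π`, so `KL(q ‖ π) = O(log n)`.

For a fixed separation `ε`, tests at a fixed radius give the alternative `A` posterior mass at most
polynomial times `exp(-2an)`. The entropy inequality `t q(A) ≤ KL(q ‖ π) + exp(t) π(A)` with `t =
an` then gives `q(A) = O(log n / n)`.

All random bounds fail with summable probability, so Borel–Cantelli makes them hold eventually,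
almost surely, whatever the joint law of the samples. `IsVariationalPosterior.measure_le` is the
deterministic core; `ae_eventually_setLIntegral_lik_le` supplies the testing bound. -/

/-! ### Entropy inequalities -/

/-- Young's inequality: the convex conjugate of `klFun` is `exp t - 1`, and the `-1` is given away.
-/
theorem mul_le_klFun_add_exp {r t : ℝ} (hr : 0 ≤ r) :
    t * r ≤ InformationTheory.klFun r + Real.exp t := by
  rw [InformationTheory.klFun_apply]
  rcases hr.eq_or_lt with rfl | hr
  · simp; positivity
  · have h := Real.add_one_le_exp (t - Real.log r)
    rw [Real.exp_sub, Real.exp_log hr, le_div_iff₀ hr] at h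
    nlinarith

/-- A variational (Fenchel–Young) bound for the mass that `q` gives to a set. -/
theorem ofReal_mul_measure_le_klDiv_add {α : Type*} [MeasurableSpace α] (q π : Measure α)
    [IsFiniteMeasure q] [IsFiniteMeasure π] (A : Set α) {t : ℝ}
    (ht : 0 ≤ t) :
    ENNReal.ofReal t * q A ≤
      InformationTheory.klDiv q π + ENNReal.ofReal (Real.exp t) * π A := by
  by_cases hac : q ≪ π
  swap
  · simp [InformationTheory.klDiv_of_not_ac hac]
  rw [InformationTheory.klDiv_eq_lintegral_klFun_of_ac hac, ← Measure.setLIntegral_rnDeriv hac A,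
    ← lintegral_const_mul _ (Measure.measurable_rnDeriv _ _)]
  calc ∫⁻ x in A, ENNReal.ofReal t * q.rnDeriv π x ∂π
      ≤ ∫⁻ x in A, (ENNReal.ofReal (InformationTheory.klFun (q.rnDeriv π x).toReal) +
          ENNReal.ofReal (Real.exp t)) ∂π := by
        refine lintegral_mono_ae (ae_restrict_of_ae ?_)
        filter_upwards [Measure.rnDeriv_ne_top q π] with x hx
        rw [← ENNReal.ofReal_add (InformationTheory.klFun_nonneg ENNReal.toReal_nonneg)
          (Real.exp_pos t).le]
        conv_lhs => rw [← ENNReal.ofReal_toReal hx, ← ENNReal.ofReal_mul ht]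
        exact ENNReal.ofReal_le_ofReal (mul_le_klFun_add_exp ENNReal.toReal_nonneg)
    _ = (∫⁻ x in A, ENNReal.ofReal (InformationTheory.klFun (q.rnDeriv π x).toReal) ∂π) +
          ENNReal.ofReal (Real.exp t) * π A := by
        rw [lintegral_add_right _ measurable_const, setLIntegral_const]
    _ ≤ _ := by
        gcongr
        exact Measure.restrict_le_self

/-- The density `r` of `q` is at most `K`, so `klFun r ≤ r log K + 1`; integrate against `π`. The
sharp bound is `log K`, but the extra `1` is harmless and keeps every integrand nonnegative. -/
theorem klDiv_le_of_le_smul {α : Type*} [MeasurableSpace α] (q π : Measure α)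
    [IsProbabilityMeasure q] [IsProbabilityMeasure π] {K : ℝ} (hK : 1 ≤ K)
    (h : q ≤ ENNReal.ofReal K • π) :
    InformationTheory.klDiv q π ≤ ENNReal.ofReal (Real.log K + 1) := by
  have hac : q ≪ π := (Measure.absolutelyContinuous_of_le h).trans
    (Measure.smul_absolutelyContinuous)
  have hd : ∀ᵐ x ∂π, q.rnDeriv π x ≤ ENNReal.ofReal K := by
    refine ae_le_of_forall_setLIntegral_le_of_sigmaFinite (Measure.measurable_rnDeriv _ _)
      fun s _ _ => ?_
    rw [Measure.setLIntegral_rnDeriv hac, setLIntegral_const]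
    exact h s
  have hlog : 0 ≤ Real.log K := Real.log_nonneg hK
  rw [InformationTheory.klDiv_eq_lintegral_klFun_of_ac hac]
  calc _ ≤ ∫⁻ x, (q.rnDeriv π x * ENNReal.ofReal (Real.log K) + 1) ∂π := by
        refine lintegral_mono_ae ?_
        filter_upwards [hd] with x hx
        have hfin : q.rnDeriv π x ≠ ⊤ := ne_top_of_le_ne_top ENNReal.ofReal_ne_top hx
        have hr : (q.rnDeriv π x).toReal ≤ K :=
          ENNReal.toReal_le_of_le_ofReal (by linarith) hx
        conv_rhs => rw [← ENNReal.ofReal_toReal hfin, ← ENNReal.ofReal_mul ENNReal.toReal_nonneg,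
          ← ENNReal.ofReal_one, ← ENNReal.ofReal_add
            (mul_nonneg ENNReal.toReal_nonneg hlog) zero_le_one]
        apply ENNReal.ofReal_le_ofReal
        rw [InformationTheory.klFun_apply]
        rcases (ENNReal.toReal_nonneg (a := q.rnDeriv π x)).eq_or_lt with h0 | h0
        · simp [← h0]
        · have := mul_le_mul_of_nonneg_left (Real.log_le_log h0 hr) h0.le
          linarith
    _ = ENNReal.ofReal (Real.log K) + 1 := by
        rw [lintegral_add_right _ measurable_const,
          lintegral_mul_const _ (Measure.measurable_rnDeriv _ _), Measure.lintegral_rnDeriv hac]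
        simp
    _ = _ := by rw [ENNReal.ofReal_add hlog zero_le_one, ENNReal.ofReal_one]

/-! ### Borel–Cantelli, Markov and Rényi bounds -/

theorem ae_eventually_notMem_of_law_le {S : ℕ → Type*} [∀ n, MeasurableSpace (S n)]
    {Ω : Type*} [MeasurableSpace Ω] {P : Measure Ω} {data : ∀ n, Ω → S n}
    (hdata : ∀ n, Measurable (data n)) {law : ∀ n, Measure (S n)}
    (hlaw : ∀ n : ℕ, 1 ≤ n → P.map (data n) = law n) {B : ∀ n, Set (S n)} {a : ℕ → ℝ}
    (ha : Summable a) (hB : ∀ᶠ n in atTop, law n (B n) ≤ ENNReal.ofReal (a n)) :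
    ∀ᵐ ω ∂P, ∀ᶠ n in atTop, data n ω ∉ B n := by
  obtain ⟨N, hN⟩ := eventually_atTop.1 (hB.and (eventually_ge_atTop 1))
  have hs : ∑' n, P {ω | data (n + N) ω ∈ B (n + N)} ≠ ⊤ := by
    have hle : ∀ n, P {ω | data (n + N) ω ∈ B (n + N)} ≤ ENNReal.ofReal (a (n + N)) := by
      intro n
      obtain ⟨h1, h2⟩ := hN (n + N) (Nat.le_add_left _ _)
      rw [← hlaw _ h2] at h1
      exact (Measure.le_map_apply (hdata _).aemeasurable _).trans h1
    refine ne_top_of_le_ne_top ?_ (ENNReal.tsum_le_tsum hle)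
    exact ((summable_nat_add_iff N).2 ha).tsum_ofReal_ne_top
  filter_upwards [ae_eventually_notMem hs] with ω hω
  obtain ⟨m, hm⟩ := eventually_atTop.1 hω
  refine eventually_atTop.2 ⟨m + N, fun n hn => ?_⟩
  have := hm (n - N) (by omega)
  rwa [Nat.sub_add_cancel (by omega)] at this

/-- Markov's inequality for the ratio `f / p` under the law with density `p`, in product form so
that zeros of `p` need no care. -/
theorem withDensity_mul_lt_le {S : Type*} [MeasurableSpace S] (μ : Measure S)
    {p f : S → ENNReal} (hp : Measurable p) (hf : Measurable f) {t : ENNReal}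
    (ht : t ≠ 0) (ht' : t ≠ ⊤) :
    μ.withDensity p {x | t * p x < f x} ≤ (∫⁻ x, f x ∂μ) / t := by
  have hm : MeasurableSet {x | t * p x < f x} := measurableSet_lt (hp.const_mul t) hf
  rw [withDensity_apply _ hm, ENNReal.div_eq_inv_mul, ← lintegral_const_mul _ hf]
  calc _ ≤ ∫⁻ x in {x | t * p x < f x}, t⁻¹ * f x ∂μ := by
        refine setLIntegral_mono (hf.const_mul _) fun x hx => ?_
        rw [← ENNReal.div_eq_inv_mul, ENNReal.le_div_iff_mul_le (Or.inl ht) (Or.inl ht'),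
          mul_comm]
        exact (le_of_lt hx)
    _ ≤ _ := by
      gcongr
      exact Measure.restrict_le_self

/-- By Hölder against the constant `1`, `1 = ∫ dP/dQ dQ ≤ (∫ (dP/dQ)^ρ dQ)^(1/ρ)`. -/
theorem renyiDiv_nonneg {S : Type*} [MeasurableSpace S] {ρ : ℝ} (hρ : 1 < ρ) (P Q : Measure S)
    [IsProbabilityMeasure P] [IsProbabilityMeasure Q] : 0 ≤ renyiDiv ρ P Q := by
  unfold renyiDiv
  rw [if_neg hρ.ne']
  split_ifs with h
  · exact le_top
  have hac : P ≪ Q := by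
    by_contra hn
    exact h ⟨hρ, hn⟩
  refine mul_nonneg (EReal.coe_nonneg.2 (inv_nonneg.2 (by linarith))) ?_
  have hc : ρ.HolderConjugate ρ.conjExponent := Real.HolderConjugate.conjExponent hρ
  have h1 := ENNReal.lintegral_mul_le_Lp_mul_Lq Q hc
    (Measure.measurable_rnDeriv P Q).aemeasurable (aemeasurable_const (b := (1 : ENNReal)))
  simp only [Pi.mul_apply, mul_one, Measure.lintegral_rnDeriv hac, measure_univ,
    ENNReal.one_rpow, lintegral_const] at h1
  rw [← ENNReal.log_one]
  apply ENNReal.log_monotone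
  by_contra hlt
  push Not at hlt
  exact absurd h1 (not_le.2 (ENNReal.rpow_lt_one hlt (by positivity)))

/-! ### Euclidean distance and boxes -/

theorem paramDist_nonneg {dx dy : ℕ} (θ θ' : Param dx dy) : 0 ≤ paramDist θ θ' :=
  Real.sqrt_nonneg _

theorem measurable_paramDist {dx dy : ℕ} (θ' : Param dx dy) :
    Measurable fun θ : Param dx dy => paramDist θ θ' := by
  unfold paramDist
  fun_prop

theorem eq_of_paramDist_eq_zero {dx dy : ℕ} {θ θ' : Param dx dy} (h : paramDist θ θ' = 0) :
    θ = θ' := by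
  unfold paramDist at h
  rw [Real.sqrt_eq_zero (by positivity)] at h
  have h1 : ‖θ.1 - θ'.1‖ = 0 := by nlinarith [sq_nonneg ‖θ.1 - θ'.1‖, sq_nonneg ‖θ.2 - θ'.2‖]
  have h2 : ‖θ.2 - θ'.2‖ = 0 := by nlinarith [sq_nonneg ‖θ.1 - θ'.1‖, sq_nonneg ‖θ.2 - θ'.2‖]
  exact Prod.ext (sub_eq_zero.1 (norm_eq_zero.1 h1)) (sub_eq_zero.1 (norm_eq_zero.1 h2))

theorem paramDist_le_two_mul {dx dy : ℕ} {θ θ' : Param dx dy} {r : ℝ}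
    (h1 : ‖θ.1 - θ'.1‖ ≤ r) (h2 : ‖θ.2 - θ'.2‖ ≤ r) : paramDist θ θ' ≤ 2 * r := by
  have hr : 0 ≤ r := (norm_nonneg _).trans h1
  refine Real.sqrt_le_iff.2 ⟨by positivity, ?_⟩
  have := pow_le_pow_left₀ (norm_nonneg _) h1 2
  have := pow_le_pow_left₀ (norm_nonneg _) h2 2
  nlinarith [sq_nonneg r]

theorem norm_fst_sub_le_paramDist {dx dy : ℕ} (θ θ' : Param dx dy) :
    ‖θ.1 - θ'.1‖ ≤ paramDist θ θ' :=
  Real.le_sqrt_of_sq_le (by nlinarith [sq_nonneg ‖θ.2 - θ'.2‖])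

theorem norm_snd_sub_le_paramDist {dx dy : ℕ} (θ θ' : Param dx dy) :
    ‖θ.2 - θ'.2‖ ≤ paramDist θ θ' :=
  Real.le_sqrt_of_sq_le (by nlinarith [sq_nonneg ‖θ.1 - θ'.1‖])

theorem exp_neg_mul_le_of_abs_log_sub_le {a b t : ℝ} (ha : 0 < a) (hb : 0 < b)
    (h : |Real.log a - Real.log b| ≤ t) : Real.exp (-t) * b ≤ a := by
  have h1 := (abs_le.1 h).1
  calc Real.exp (-t) * b = Real.exp (-t + Real.log b) := by rw [Real.exp_add, Real.exp_log hb]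
    _ ≤ Real.exp (Real.log a) := Real.exp_le_exp.2 (by linarith)
    _ = a := Real.exp_log ha

/-- The uniform distribution on a box belongs to the mean-field family. -/
theorem uniform_mem_meanFieldFamily {dx dy : ℕ} {X Bx : Set (EuclideanSpace ℝ (Fin dx))}
    {Y By : Set (EuclideanSpace ℝ (Fin dy))} (hBx : Bx ⊆ X) (hBy : By ⊆ Y)
    (hX : MeasurableSet X) (hY : MeasurableSet Y)
    (h0 : volume (Bx ×ˢ By) ≠ 0) (hx : volume Bx ≠ ⊤) (hy : volume By ≠ ⊤) :
    (volume (Bx ×ˢ By))⁻¹ • volume.restrict (Bx ×ˢ By) ∈ meanFieldFamily X Y := by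
  have hv : volume (Bx ×ˢ By) = volume Bx * volume By := Measure.prod_prod Bx By
  rw [hv, mul_ne_zero_iff] at h0
  have aux : ∀ {k : ℕ} {Z B : Set (EuclideanSpace ℝ (Fin k))}, B ⊆ Z → MeasurableSet Z →
      ((volume B)⁻¹ • volume.restrict B) Zᶜ = 0 := by
    intro k Z B h hZ
    rw [Measure.smul_apply, Measure.restrict_apply hZ.compl,
      (Set.disjoint_compl_left_iff_subset.2 h).inter_eq]
    simp
  refine ⟨(volume Bx)⁻¹ • volume.restrict Bx, (volume By)⁻¹ • volume.restrict By,
    ⟨?_⟩, ⟨?_⟩, aux hBx hX, aux hBy hY, ?_⟩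
  · simp [ENNReal.inv_mul_cancel h0.1 hx]
  · simp [ENNReal.inv_mul_cancel h0.2 hy]
  · rw [Measure.prod_smul_left, Measure.prod_smul_right, Measure.prod_restrict, smul_smul, hv,
      ENNReal.mul_inv (Or.inl h0.1) (Or.inl hx)]
    rfl

/-! ### Prior, posterior and the deterministic bound on the variational mass -/

namespace BayesModel

variable {dx dy : ℕ} {S : ℕ → Type*} [∀ n, MeasurableSpace (S n)]

theorem measurableSet_paramSet (M : BayesModel dx dy S) : MeasurableSet M.paramSet :=
  M.measurableSet_X.prod M.measurableSet_Y

theorem measurable_lik_left (M : BayesModel dx dy S) (n : ℕ) (x : S n) :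
    Measurable fun θ => M.lik n θ x :=
  (M.measurable_lik n).comp (measurable_id.prodMk measurable_const)

theorem measurable_lik_right (M : BayesModel dx dy S) (n : ℕ) (θ : Param dx dy) :
    Measurable (M.lik n θ) :=
  (M.measurable_lik n).comp (measurable_const.prodMk measurable_id)

instance isProbabilityMeasure_prior (M : BayesModel dx dy S) : IsProbabilityMeasure M.prior := by
  constructor
  rw [prior, withDensity_apply _ MeasurableSet.univ, Measure.restrict_univ]
  exact M.lintegral_priorDensity

theorem prior_compl_paramSet (M : BayesModel dx dy S) : M.prior M.paramSetᶜ = 0 := by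
  refine withDensity_absolutelyContinuous _ _ ?_
  rw [Measure.restrict_apply M.measurableSet_paramSet.compl]
  simp

theorem isProbabilityMeasure_dataLaw (M : BayesModel dx dy S) (n : ℕ) {θ : Param dx dy}
    (hθ : θ ∈ M.paramSet) : IsProbabilityMeasure (M.dataLaw n θ) := by
  constructor
  rw [dataLaw, withDensity_apply _ MeasurableSet.univ, Measure.restrict_univ]
  exact M.lintegral_lik n θ hθ

theorem setLIntegral_prior (M : BayesModel dx dy S) {f : Param dx dy → ENNReal}
    (hf : Measurable f) {s : Set (Param dx dy)} (hs : MeasurableSet s) :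
    ∫⁻ θ in s, f θ ∂M.prior =
      ∫⁻ θ in s ∩ M.paramSet, ENNReal.ofReal (M.priorDensity θ) * f θ := by
  rw [prior, setLIntegral_withDensity_eq_setLIntegral_mul _
    M.measurable_priorDensity.ennreal_ofReal hf hs, Measure.restrict_restrict hs]
  rfl

theorem posterior_apply (M : BayesModel dx dy S) (n : ℕ) (x : S n) {s : Set (Param dx dy)}
    (hs : MeasurableSet s) :
    M.posterior n x s =
      (M.evidence n x)⁻¹ * ∫⁻ θ in s, ENNReal.ofReal (M.lik n θ x) ∂M.prior := by
  rw [posterior, Measure.smul_apply, withDensity_apply _ hs, smul_eq_mul]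

theorem isProbabilityMeasure_posterior (M : BayesModel dx dy S) (n : ℕ) (x : S n)
    (h0 : M.evidence n x ≠ 0) (h1 : M.evidence n x ≠ ⊤) :
    IsProbabilityMeasure (M.posterior n x) := by
  constructor
  rw [M.posterior_apply n x MeasurableSet.univ, Measure.restrict_univ]
  exact ENNReal.inv_mul_cancel h0 h1

theorem IsVariationalPosterior.isProbabilityMeasure {M : BayesModel dx dy S} {n : ℕ} {x : S n}
    {q : Measure (Param dx dy)} (hq : M.IsVariationalPosterior n x q) :
    IsProbabilityMeasure q := by
  obtain ⟨⟨qx, qy, h1, h2, -, -, rfl⟩, -⟩ := hq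
  infer_instance

theorem IsVariationalPosterior.measure_compl_paramSet {M : BayesModel dx dy S} {n : ℕ} {x : S n}
    {q : Measure (Param dx dy)} (hq : M.IsVariationalPosterior n x q) :
    q M.paramSetᶜ = 0 := by
  obtain ⟨⟨qx, qy, h1, h2, hx, hy, rfl⟩, -⟩ := hq
  rw [paramSet, Set.compl_prod_eq_union]
  refine measure_union_null ?_ ?_
  · rw [Measure.prod_prod, hx, zero_mul]
  · rw [Measure.prod_prod, hy, mul_zero]

/-- Bound for the mass that the variational posterior gives to a set `A`, when the prior density
times the likelihood is at least `κ p` on a box of volume at least `v`. -/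
theorem IsVariationalPosterior.measure_le {M : BayesModel dx dy S} {n : ℕ} {x : S n}
    {q : Measure (Param dx dy)} (hq : M.IsVariationalPosterior n x q)
    {Bx : Set (EuclideanSpace ℝ (Fin dx))} {By : Set (EuclideanSpace ℝ (Fin dy))}
    (hBx : Bx ⊆ M.X) (hBy : By ⊆ M.Y) (hmx : MeasurableSet Bx) (hmy : MeasurableSet By)
    (hx : volume Bx ≠ ⊤) (hy : volume By ≠ ⊤)
    {v κ p E δ t : ℝ} (hv : 0 < v) (hκ : 0 < κ) (hp : 0 < p) (hE : 0 < E) (hδ : 0 ≤ δ)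
    (ht : 0 < t) (hvol : ENNReal.ofReal v ≤ volume (Bx ×ˢ By))
    (hlow : ∀ θ ∈ Bx ×ˢ By, κ * p ≤ M.priorDensity θ * M.lik n θ x)
    (hev : M.evidence n x ≤ ENNReal.ofReal (E * p))
    {A : Set (Param dx dy)} (hA : MeasurableSet A)
    (hnum : ∫⁻ θ in A, ENNReal.ofReal (M.lik n θ x) ∂M.prior ≤ ENNReal.ofReal (δ * p)) :
    q A ≤ ENNReal.ofReal
      ((Real.log (E / (v * κ)) + 1 + Real.exp t * (δ / (v * κ))) / t) := by
  have hqp := hq.isProbabilityMeasure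
  have hsub : Bx ×ˢ By ⊆ M.paramSet := Set.prod_mono hBx hBy
  have hmB : MeasurableSet (Bx ×ˢ By) := hmx.prod hmy
  have hlik := (M.measurable_lik_left n x).ennreal_ofReal
  have hnumlow : ∀ s, MeasurableSet s → ENNReal.ofReal (κ * p) * volume (s ∩ Bx ×ˢ By) ≤
      ∫⁻ θ in s, ENNReal.ofReal (M.lik n θ x) ∂M.prior := by
    intro s hs
    rw [M.setLIntegral_prior hlik hs, ← setLIntegral_const]
    refine (setLIntegral_mono' (hs.inter hmB) fun θ hθ => ?_).trans
      (lintegral_mono_set (Set.inter_subset_inter_right s hsub))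
    rw [← ENNReal.ofReal_mul (M.priorDensity_nonneg θ (hsub hθ.2))]
    exact ENNReal.ofReal_le_ofReal (hlow θ hθ.2)
  have hevlow : ENNReal.ofReal (v * κ * p) ≤ M.evidence n x := by
    have := hnumlow Set.univ MeasurableSet.univ
    rw [Set.univ_inter, Measure.restrict_univ] at this
    refine le_trans ?_ this
    rw [mul_assoc, mul_comm, ENNReal.ofReal_mul (by positivity)]
    gcongr
  have hev0 : M.evidence n x ≠ 0 :=
    (lt_of_lt_of_le (ENNReal.ofReal_pos.2 (by positivity)) hevlow).ne'
  have hevt : M.evidence n x ≠ ⊤ := ne_top_of_le_ne_top ENNReal.ofReal_ne_top hev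
  have hpost := M.isProbabilityMeasure_posterior n x hev0 hevt
  -- The evidence is squeezed between `v κ p` and `E p`.
  have hK : 1 ≤ E / (v * κ) := by
    rw [one_le_div (by positivity)]
    have := (ENNReal.ofReal_le_ofReal_iff (by positivity)).1 (hevlow.trans hev)
    exact le_of_mul_le_mul_right this hp
  have hvol0 : volume (Bx ×ˢ By) ≠ 0 :=
    (lt_of_lt_of_le (ENNReal.ofReal_pos.2 hv) hvol).ne'
  have hu := uniform_mem_meanFieldFamily hBx hBy M.measurableSet_X M.measurableSet_Y hvol0 hx hy
  set u : Measure (Param dx dy) := (volume (Bx ×ˢ By))⁻¹ • volume.restrict (Bx ×ˢ By) with hu_def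
  have hup : IsProbabilityMeasure u := by
    obtain ⟨qx, qy, h1, h2, -, -, h⟩ := hu
    rw [h]
    infer_instance
  -- On the box, `u` has Lebesgue density at most `1 / v` and the posterior at least `κ p / (E p)`.
  have hle : u ≤ ENNReal.ofReal (E / (v * κ)) • M.posterior n x := by
    refine Measure.le_iff.2 fun s hs => ?_
    rw [hu_def, Measure.smul_apply, Measure.restrict_apply hs, Measure.smul_apply,
      M.posterior_apply n x hs, smul_eq_mul, smul_eq_mul]
    calc _ ≤ ENNReal.ofReal v⁻¹ * volume (s ∩ Bx ×ˢ By) := by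
          rw [ENNReal.ofReal_inv_of_pos hv]
          gcongr
      _ = ENNReal.ofReal (E / (v * κ)) * (ENNReal.ofReal (E * p)⁻¹ *
            (ENNReal.ofReal (κ * p) * volume (s ∩ Bx ×ˢ By))) := by
          rw [← mul_assoc, ← mul_assoc, ← ENNReal.ofReal_mul (by positivity),
            ← ENNReal.ofReal_mul (by positivity)]
          congr 2
          field_simp
      _ ≤ _ := by
          rw [ENNReal.ofReal_inv_of_pos (by positivity)]
          gcongr
          exact hnumlow s hs
  have hkl := (hq.2 u hu).trans (klDiv_le_of_le_smul u _ hK hle)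
  have hpostA : M.posterior n x A ≤ ENNReal.ofReal (δ / (v * κ)) := by
    rw [M.posterior_apply n x hA]
    calc _ ≤ ENNReal.ofReal (v * κ * p)⁻¹ * ENNReal.ofReal (δ * p) := by
          rw [ENNReal.ofReal_inv_of_pos (by positivity)]
          gcongr
      _ = _ := by
          rw [← ENNReal.ofReal_mul (by positivity)]
          congr 1
          field_simp
  have hmain := ofReal_mul_measure_le_klDiv_add q (M.posterior n x) A ht.le
  rw [ENNReal.ofReal_div_of_pos ht, ENNReal.le_div_iff_mul_le
    (Or.inl (ENNReal.ofReal_pos.2 ht).ne') (Or.inl ENNReal.ofReal_ne_top), mul_comm]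
  refine hmain.trans ?_
  have hl := Real.log_nonneg hK
  rw [ENNReal.ofReal_add (by positivity) (by positivity), ENNReal.ofReal_mul (Real.exp_pos t).le]
  gcongr

end BayesModel

/-! ### Fubini for the likelihood, and tests -/

namespace BayesModel

variable {dx dy : ℕ} {S : ℕ → Type*} [∀ n, MeasurableSpace (S n)]

theorem measurable_setLIntegral_lik (M : BayesModel dx dy S) (n : ℕ) (A : Set (Param dx dy)) :
    Measurable fun x => ∫⁻ θ in A, ENNReal.ofReal (M.lik n θ x) ∂M.prior :=
  Measurable.lintegral_prod_left' (M.measurable_lik n).ennreal_ofReal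

theorem lintegral_mul_setLIntegral_lik (M : BayesModel dx dy S) (n : ℕ) (A : Set (Param dx dy))
    {w : S n → ENNReal} (hw : Measurable w) :
    ∫⁻ x, w x * ∫⁻ θ in A, ENNReal.ofReal (M.lik n θ x) ∂M.prior ∂(M.base n) =
      ∫⁻ θ in A, ∫⁻ x, w x ∂(M.dataLaw n θ) ∂M.prior := by
  have := M.sigmaFinite_base n
  have hm : Measurable fun z : S n × Param dx dy => w z.1 * ENNReal.ofReal (M.lik n z.2 z.1) :=
    (hw.comp measurable_fst).mul ((M.measurable_lik n).comp measurable_swap).ennreal_ofReal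
  calc _ = ∫⁻ x, ∫⁻ θ in A, w x * ENNReal.ofReal (M.lik n θ x) ∂M.prior ∂(M.base n) := by
        refine lintegral_congr fun x => ?_
        rw [lintegral_const_mul _ (M.measurable_lik_left n x).ennreal_ofReal]
    _ = ∫⁻ θ in A, ∫⁻ x, w x * ENNReal.ofReal (M.lik n θ x) ∂(M.base n) ∂M.prior :=
        lintegral_lintegral_swap hm.aemeasurable
    _ = _ := by
        refine lintegral_congr fun θ => ?_
        rw [dataLaw, lintegral_withDensity_eq_lintegral_mul _
          (M.measurable_lik_right n θ).ennreal_ofReal hw]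
        simp [mul_comm]

theorem lintegral_evidence (M : BayesModel dx dy S) (n : ℕ) :
    ∫⁻ x, M.evidence n x ∂(M.base n) = 1 := by
  have h := M.lintegral_mul_setLIntegral_lik n Set.univ (w := fun _ => 1) measurable_const
  simp only [one_mul, Measure.restrict_univ, lintegral_one] at h
  have h1 : (fun θ => M.dataLaw n θ Set.univ) =ᵐ[M.prior] fun _ => 1 := by
    filter_upwards [mem_ae_iff.2 M.prior_compl_paramSet] with θ hθ
    have := M.isProbabilityMeasure_dataLaw n hθ
    exact measure_univ
  rw [lintegral_congr_ae h1] at h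
  simpa [evidence] using h

/-- Expected likelihood mass of `A` on the acceptance region of a test of `θ₀` against `A`. -/
theorem lintegral_test_mul_le (M : BayesModel dx dy S) (n : ℕ) {A T : Set (Param dx dy)}
    (hA : MeasurableSet A) (hT : MeasurableSet T) {φ : S n → ℝ} (hφ : Measurable φ)
    (hφ01 : ∀ x, φ x ∈ Set.Icc (0 : ℝ) 1) {δ : ℝ}
    (htest : ∀ θ ∈ T, θ ∈ A → θ ∈ M.paramSet → ∫ x, (1 - φ x) ∂(M.dataLaw n θ) ≤ δ)
    (hprior : M.prior Tᶜ ≤ ENNReal.ofReal δ) :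
    ∫⁻ x, ENNReal.ofReal (1 - φ x) *
        ∫⁻ θ in A, ENNReal.ofReal (M.lik n θ x) ∂M.prior ∂(M.base n) ≤
      2 * ENNReal.ofReal δ := by
  rw [M.lintegral_mul_setLIntegral_lik n A (w := fun x => ENNReal.ofReal (1 - φ x))
    (measurable_const.sub hφ).ennreal_ofReal]
  calc _ ≤ ∫⁻ θ in A, (ENNReal.ofReal δ + Tᶜ.indicator 1 θ) ∂M.prior := by
        refine lintegral_mono_ae ?_
        filter_upwards [ae_restrict_of_ae (mem_ae_iff.2 M.prior_compl_paramSet),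
          ae_restrict_mem hA] with θ hθ hθA
        have := M.isProbabilityMeasure_dataLaw n hθ
        by_cases hθT : θ ∈ T
        · refine le_trans ?_ le_self_add
          rw [← ofReal_integral_eq_lintegral_ofReal]
          · exact ENNReal.ofReal_le_ofReal (htest θ hθT hθA hθ)
          · refine Integrable.of_bound (measurable_const.sub hφ).aestronglyMeasurable 1
              (ae_of_all _ fun x => ?_)
            rw [Real.norm_eq_abs, abs_le]
            constructor <;> linarith [(hφ01 x).1, (hφ01 x).2]
          · exact ae_of_all _ fun x => sub_nonneg.2 (hφ01 x).2
        -- Off `T` the test gives nothing: the inner integral is bounded by `1`, and the small prior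
        -- mass of `Tᶜ` pays for it.
        · rw [Set.indicator_of_mem (by exact hθT)]
          refine le_trans ?_ le_add_self
          calc _ ≤ ∫⁻ _, 1 ∂(M.dataLaw n θ) := lintegral_mono fun x => by
                  rw [← ENNReal.ofReal_one]
                  exact ENNReal.ofReal_le_ofReal (by linarith [(hφ01 x).1])
            _ = 1 := by simp
    _ ≤ ∫⁻ θ, (ENNReal.ofReal δ + Tᶜ.indicator 1 θ) ∂M.prior :=
        lintegral_mono' Measure.restrict_le_self le_rfl
    _ ≤ _ := by
        rw [lintegral_add_left measurable_const, lintegral_const, measure_univ, mul_one,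
          lintegral_indicator_one hT.compl, two_mul]
        gcongr

/-- A set of positive prior mass is nonempty, and Rényi divergences are nonnegative. Together with
`C₂ + 2 < C` this makes the testing exponent positive. -/
theorem PriorMassCondition.nonneg {M : BayesModel dx dy S} {θ₀ : Param dx dy} {eps : ℕ → ℝ}
    {C₂ C : ℝ} {sieve : ℕ → ℝ → Set (Param dx dy)} (hθ₀ : θ₀ ∈ M.paramSet)
    (h : M.PriorMassCondition θ₀ eps C₂ C sieve) (heps : 0 < eps 1) : 0 ≤ C₂ := by
  obtain ⟨-, ρ, hρ, h⟩ := h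
  obtain ⟨θ, hθ, hD⟩ := nonempty_of_measure_ne_zero (h 1 le_rfl).ne'
  have := M.isProbabilityMeasure_dataLaw 1 hθ
  have := M.isProbabilityMeasure_dataLaw 1 hθ₀
  have h2 := EReal.coe_nonneg.1 ((renyiDiv_nonneg hρ _ _).trans hD)
  by_contra hC
  push Not at hC
  have : 0 < eps 1 ^ 2 := by positivity
  push_cast at h2
  nlinarith

end BayesModel

/-! ### Numerical limits -/

theorem measure_lt_le_ofReal_integral_div {S : Type*} [MeasurableSpace S] {μ : Measure S}
    {f : S → ℝ} (hf : Integrable f μ) (h0 : 0 ≤ᵐ[μ] f) {t : ℝ} (ht : 0 < t) :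
    μ {x | t < f x} ≤ ENNReal.ofReal ((∫ x, f x ∂μ) / t) := by
  rw [ENNReal.ofReal_div_of_pos ht, ofReal_integral_eq_lintegral_ofReal hf h0]
  refine (measure_mono ?_).trans (meas_ge_le_lintegral_div hf.1.aemeasurable.ennreal_ofReal
    (ENNReal.ofReal_pos.2 ht).ne' ENNReal.ofReal_ne_top)
  exact fun x hx => ENNReal.ofReal_le_ofReal (le_of_lt hx)

theorem summable_exp_neg_mul {a : ℝ} (ha : 0 < a) :
    Summable fun n : ℕ => Real.exp (-(a * n)) := by
  refine (Real.summable_exp_nat_mul_iff.2 (neg_lt_zero.2 ha)).congr fun n => ?_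
  congr 1
  ring

/-- This is the bound of `IsVariationalPosterior.measure_le` with `E = n²`, `v κ = b n^(-4d)`, `δ =
2 exp(-2an)` and `t = an`: the logarithm is `O(log n)`, and the other term is `n^(4d) exp(-an)` up
to a constant. -/
theorem tendsto_log_add_exp_div {a b : ℝ} (ha : 0 < a) (hb : 0 < b) (d : ℕ) :
    Tendsto (fun n : ℕ => (Real.log ((n : ℝ) ^ 2 / (b * ((n ^ 4 : ℝ)⁻¹) ^ d)) + 1 +
      Real.exp (a * n) * (2 * Real.exp (-(2 * a * n)) / (b * ((n ^ 4 : ℝ)⁻¹) ^ d))) / (a * n))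
      atTop (𝓝 0) := by
  have hn : Tendsto (fun n : ℕ => (n : ℝ)) atTop atTop := tendsto_natCast_atTop_atTop
  have h1 : Tendsto (fun n : ℕ => Real.log n / (n : ℝ)) atTop (𝓝 0) :=
    (Real.isLittleO_log_id_atTop.tendsto_div_nhds_zero).comp hn
  have h2 : Tendsto (fun n : ℕ => (n : ℝ)⁻¹) atTop (𝓝 0) := tendsto_inv_atTop_zero.comp hn
  have h3 : Tendsto (fun n : ℕ => (n : ℝ) ^ (4 * d) * Real.exp (-(a * n))) atTop (𝓝 0) := by
    have h := (Real.tendsto_pow_mul_exp_neg_atTop_nhds_zero (4 * d)).comp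
      (hn.const_mul_atTop ha)
    have h' := h.const_mul ((a ^ (4 * d))⁻¹)
    rw [mul_zero] at h'
    refine h'.congr fun n => ?_
    simp only [Function.comp_apply, mul_pow]
    have : a ^ (4 * d) ≠ 0 := by positivity
    field_simp
  have h := (((h1.const_mul (2 + 4 * d : ℝ)).add (h2.const_mul (1 - Real.log b))).add
    ((h3.const_mul (2 / b)).mul h2)).const_mul a⁻¹
  simp only [mul_zero, add_zero] at h
  refine h.congr' ?_
  filter_upwards [eventually_ge_atTop 1] with n hn1
  have hn0 : (0 : ℝ) < n := by exact_mod_cast hn1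
  have e1 : (n : ℝ) ^ 2 / (b * ((n ^ 4 : ℝ)⁻¹) ^ d) = n ^ (2 + 4 * d) / b := by
    rw [inv_pow, ← pow_mul, pow_add]
    field_simp
  have e2 : Real.exp (a * n) * (2 * Real.exp (-(2 * a * n)) / (b * ((n ^ 4 : ℝ)⁻¹) ^ d)) =
      2 / b * ((n : ℝ) ^ (4 * d) * Real.exp (-(a * n))) := by
    have : Real.exp (-(a * n)) = Real.exp (a * n) * Real.exp (-(2 * a * n)) := by
      rw [← Real.exp_add]
      congr 1
      ring
    rw [this, inv_pow, ← pow_mul]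
    field_simp
  rw [e1, e2, Real.log_div (by positivity) hb.ne', Real.log_pow]
  push_cast
  field_simp
  ring

/-! ### Almost sure bounds along the data -/

namespace BayesModel

variable {dx dy : ℕ} {S : ℕ → Type*} [∀ n, MeasurableSpace (S n)]

/-- The part of the parameter set within distance `r` of `θ₀` lies in a product box. -/
theorem exists_box (M : BayesModel dx dy S) (θ₀ : Param dx dy) (r : ℝ) :
    ∃ (Bx : Set (EuclideanSpace ℝ (Fin dx))) (By : Set (EuclideanSpace ℝ (Fin dy))),
      Bx ⊆ M.X ∧ By ⊆ M.Y ∧ MeasurableSet Bx ∧ MeasurableSet By ∧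
      volume Bx ≠ ⊤ ∧ volume By ≠ ⊤ ∧
      volume {θ | θ ∈ M.paramSet ∧ paramDist θ θ₀ < r} ≤ volume (Bx ×ˢ By) ∧
      ∀ θ ∈ Bx ×ˢ By, paramDist θ θ₀ ≤ 2 * r := by
  refine ⟨M.X ∩ Metric.ball θ₀.1 r, M.Y ∩ Metric.ball θ₀.2 r, Set.inter_subset_left,
    Set.inter_subset_left, M.measurableSet_X.inter measurableSet_ball,
    M.measurableSet_Y.inter measurableSet_ball,
    measure_ne_top_of_subset Set.inter_subset_right measure_ball_lt_top.ne,
    measure_ne_top_of_subset Set.inter_subset_right measure_ball_lt_top.ne,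
    measure_mono ?_, ?_⟩
  · rintro θ ⟨hθ, hd⟩
    refine ⟨⟨hθ.1, ?_⟩, ⟨hθ.2, ?_⟩⟩
    · rw [Metric.mem_ball, dist_eq_norm]
      exact (norm_fst_sub_le_paramDist θ θ₀).trans_lt hd
    · rw [Metric.mem_ball, dist_eq_norm]
      exact (norm_snd_sub_le_paramDist θ θ₀).trans_lt hd
  · rintro θ ⟨⟨-, h1⟩, ⟨-, h2⟩⟩
    rw [Metric.mem_ball, dist_eq_norm] at h1 h2
    exact paramDist_le_two_mul h1.le h2.le

/-- If the tests exist for a fixed separation, then almost surely the likelihood mass of the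
alternative is eventually exponentially small compared to the true likelihood. -/
theorem ae_eventually_setLIntegral_lik_le (M : BayesModel dx dy S) {θ₀ : Param dx dy}
    (hθ₀ : θ₀ ∈ M.paramSet) {A : Set (Param dx dy)} (hA : MeasurableSet A) {a : ℝ} (ha : 0 < a)
    (htest : ∀ᶠ n : ℕ in atTop, ∃ T : Set (Param dx dy), ∃ φ : S n → ℝ, MeasurableSet T ∧
      Measurable φ ∧ (∀ x, φ x ∈ Set.Icc (0 : ℝ) 1) ∧
      ∫ x, φ x ∂(M.dataLaw n θ₀) ≤ Real.exp (-(4 * a * n)) ∧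
      (∀ θ ∈ T, θ ∈ A → θ ∈ M.paramSet →
        ∫ x, (1 - φ x) ∂(M.dataLaw n θ) ≤ Real.exp (-(4 * a * n))) ∧
      M.prior Tᶜ ≤ ENNReal.ofReal (Real.exp (-(4 * a * n))))
    {Ω : Type*} [MeasurableSpace Ω] {P : Measure Ω} {data : ∀ n, Ω → S n}
    (hdata : ∀ n, Measurable (data n))
    (hlaw : ∀ n : ℕ, 1 ≤ n → P.map (data n) = M.dataLaw n θ₀) :
    ∀ᵐ ω ∂P, ∀ᶠ n : ℕ in atTop,
      ∫⁻ θ in A, ENNReal.ofReal (M.lik n θ (data n ω)) ∂M.prior ≤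
        ENNReal.ofReal (2 * Real.exp (-(2 * a * n)) * M.lik n θ₀ (data n ω)) := by
  -- With `s = exp(-2an)`, test errors are at most `s²`. Either `φ > 1/2`, of probability at most
  -- `2s²`, or `1 - φ ≥ 1/2` and the weighted mass exceeds `s p₀`, of probability at most `2s²/s`.
  have hbad : ∀ᶠ n : ℕ in atTop, M.dataLaw n θ₀ {x |
      ENNReal.ofReal (2 * Real.exp (-(2 * a * n)) * M.lik n θ₀ x) <
        ∫⁻ θ in A, ENNReal.ofReal (M.lik n θ x) ∂M.prior} ≤
      ENNReal.ofReal (2 * Real.exp (-(4 * a * n)) + 2 * Real.exp (-(2 * a * n))) := by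
    filter_upwards [htest] with n hn
    obtain ⟨T, φ, hT, hφ, hφ01, h1, h2, h3⟩ := hn
    have := M.isProbabilityMeasure_dataLaw n hθ₀
    set s : ℝ := Real.exp (-(2 * a * n)) with hs
    have hs0 : 0 < s := Real.exp_pos _
    have hss : Real.exp (-(4 * a * n)) = s * s := by
      rw [hs, ← Real.exp_add]
      congr 1
      ring
    rw [hss] at h1 h2 h3 ⊢
    have hφi : Integrable φ (M.dataLaw n θ₀) :=
      Integrable.of_bound hφ.aestronglyMeasurable 1 (ae_of_all _ fun x => by
        rw [Real.norm_eq_abs, abs_le]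
        constructor <;> linarith [(hφ01 x).1, (hφ01 x).2])
    have hφc : Measurable fun x => ENNReal.ofReal (1 - φ x) :=
      (measurable_const.sub hφ).ennreal_ofReal
    have m1 := measure_lt_le_ofReal_integral_div hφi (ae_of_all _ fun x => (hφ01 x).1)
      (t := 1 / 2) (by norm_num)
    have m2 := withDensity_mul_lt_le (M.base n) (M.measurable_lik_right n θ₀).ennreal_ofReal
      (hφc.mul (M.measurable_setLIntegral_lik n A))
      (t := ENNReal.ofReal s) (ENNReal.ofReal_pos.2 hs0).ne' ENNReal.ofReal_ne_top
    have m3 := M.lintegral_test_mul_le n hA hT hφ hφ01 h2 h3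
    rw [ENNReal.ofReal_add (by positivity) (by positivity)]
    refine (measure_mono ?_).trans ((measure_union_le {x | 1 / 2 < φ x} _).trans
      (add_le_add (m1.trans (ENNReal.ofReal_le_ofReal (by linarith))) (m2.trans ?_)))
    · intro x hx
      by_cases hx2 : 1 / 2 < φ x
      · exact Or.inl hx2
      · right
        push Not at hx2
        replace hx : ENNReal.ofReal (2 * s * _) < _ := hx
        rw [mul_assoc, ENNReal.ofReal_mul zero_le_two,
          ENNReal.ofReal_mul hs0.le] at hx
        change ENNReal.ofReal s * _ < ENNReal.ofReal (1 - φ x) * _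
        refine lt_of_lt_of_le ?_ (mul_le_mul_left (ENNReal.ofReal_le_ofReal
          (show (1 / 2 : ℝ) ≤ 1 - φ x by linarith)) _)
        rw [← ENNReal.mul_lt_mul_iff_right (a := ENNReal.ofReal 2) (by simp) (by simp),
          ← mul_assoc (ENNReal.ofReal 2) (ENNReal.ofReal (1 / 2)),
          ← ENNReal.ofReal_mul zero_le_two]
        simpa using hx
    · refine (ENNReal.div_le_div_right m3 _).trans (le_of_eq ?_)
      rw [← ENNReal.ofReal_ofNat 2, ← ENNReal.ofReal_mul zero_le_two,
        ← ENNReal.ofReal_div_of_pos hs0]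
      congr 1
      field_simp
  have hsum : Summable fun n : ℕ =>
      2 * Real.exp (-(4 * a * n)) + 2 * Real.exp (-(2 * a * n)) :=
    ((summable_exp_neg_mul (by positivity)).mul_left 2).add
      ((summable_exp_neg_mul (by positivity)).mul_left 2)
  filter_upwards [ae_eventually_notMem_of_law_le hdata hlaw hsum hbad] with ω hω
  filter_upwards [hω] with n hn
  exact not_lt.1 hn

/-- The evidence integrates to `1` over the sample space, so its ratio to `p₀` exceeds `n²` with
probability at most `1/n²`. -/
theorem ae_eventually_evidence_le (M : BayesModel dx dy S) {θ₀ : Param dx dy}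
    {Ω : Type*} [MeasurableSpace Ω] {P : Measure Ω} {data : ∀ n, Ω → S n}
    (hdata : ∀ n, Measurable (data n))
    (hlaw : ∀ n : ℕ, 1 ≤ n → P.map (data n) = M.dataLaw n θ₀) :
    ∀ᵐ ω ∂P, ∀ᶠ n : ℕ in atTop,
      M.evidence n (data n ω) ≤ ENNReal.ofReal ((n : ℝ) ^ 2 * M.lik n θ₀ (data n ω)) := by
  have hbad : ∀ᶠ n : ℕ in atTop, M.dataLaw n θ₀ {x |
      ENNReal.ofReal ((n : ℝ) ^ 2) * ENNReal.ofReal (M.lik n θ₀ x) < M.evidence n x} ≤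
      ENNReal.ofReal (1 / (n : ℝ) ^ 2) := by
    filter_upwards [eventually_ge_atTop 1] with n hn
    have hn0 : (0 : ℝ) < (n : ℝ) ^ 2 := by positivity
    have he : Measurable (M.evidence n) := by
      simpa [evidence] using! M.measurable_setLIntegral_lik n Set.univ
    refine (withDensity_mul_lt_le (M.base n) (M.measurable_lik_right n θ₀).ennreal_ofReal he
      (ENNReal.ofReal_pos.2 hn0).ne' ENNReal.ofReal_ne_top).trans (le_of_eq ?_)
    rw [M.lintegral_evidence n, ENNReal.ofReal_div_of_pos hn0, ENNReal.ofReal_one]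
  filter_upwards [ae_eventually_notMem_of_law_le hdata hlaw
    (Real.summable_one_div_nat_pow.2 one_lt_two) hbad] with ω hω
  filter_upwards [hω] with n hn
  rw [ENNReal.ofReal_mul (by positivity)]
  exact not_lt.1 hn

/-- The mean is eventually below `n²`, so Markov at level `n⁴` leaves a summable `1/n²`. A crude
power suffices: it only shrinks the box, which costs a logarithm. -/
theorem ae_eventually_le_pow {law : ∀ n, Measure (S n)} {f : ∀ n, S n → ℝ}
    (hf : ∀ n : ℕ, 1 ≤ n → Integrable (f n) (law n)) (h0 : ∀ n : ℕ, 1 ≤ n → 0 ≤ᵐ[law n] f n)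
    (hlim : Tendsto (fun n : ℕ => (∫ x, f n x ∂(law n)) / (n : ℝ) ^ (3 / 2 : ℝ)) atTop (𝓝 0))
    {Ω : Type*} [MeasurableSpace Ω] {P : Measure Ω} {data : ∀ n, Ω → S n}
    (hdata : ∀ n, Measurable (data n))
    (hlaw : ∀ n : ℕ, 1 ≤ n → P.map (data n) = law n) :
    ∀ᵐ ω ∂P, ∀ᶠ n : ℕ in atTop, f n (data n ω) ≤ (n : ℝ) ^ 4 := by
  have hbad : ∀ᶠ n : ℕ in atTop, law n {x | (n : ℝ) ^ 4 < f n x} ≤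
      ENNReal.ofReal (1 / (n : ℝ) ^ 2) := by
    filter_upwards [eventually_ge_atTop 1, hlim.eventually (eventually_lt_nhds one_pos)]
      with n hn h1
    have hn1 : (1 : ℝ) ≤ n := by exact_mod_cast hn
    rw [div_lt_one (by positivity)] at h1
    have h2 : (n : ℝ) ^ (3 / 2 : ℝ) ≤ (n : ℝ) ^ 2 := by
      rw [← Real.rpow_natCast]
      exact Real.rpow_le_rpow_of_exponent_le hn1 (by norm_num)
    refine (measure_lt_le_ofReal_integral_div (hf n hn) (h0 n hn) (by positivity)).trans
      (ENNReal.ofReal_le_ofReal ?_)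
    rw [div_le_div_iff₀ (by positivity) (by positivity)]
    nlinarith [sq_nonneg (n : ℝ)]
  filter_upwards [ae_eventually_notMem_of_law_le hdata hlaw
    (Real.summable_one_div_nat_pow.2 one_lt_two) hbad] with ω hω
  filter_upwards [hω] with n hn
  exact not_lt.1 hn

end BayesModel
-- Consistency
theorem theorem3 {dx dy : ℕ} {S : ℕ → Type*} [∀ n, MeasurableSpace (S n)]
    (M : BayesModel dx dy S)
    -- the true parameter, around which the parameter set is not too thin
    (θ₀ : Param dx dy) (hθ₀ : θ₀ ∈ M.paramSet)
    (hthick : ∃ c : ℝ, 0 < c ∧ ∀ r : ℝ, 0 < r → r ≤ 1 →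
      ENNReal.ofReal (c * r ^ (dx + dy)) ≤ volume {θ | θ ∈ M.paramSet ∧ paramDist θ θ₀ < r})
    -- the rate and the constants
    (eps : ℕ → ℝ) (heps_pos : ∀ n : ℕ, 1 ≤ n → 0 < eps n)
    (heps_lim : Tendsto eps atTop (𝓝 0))
    (heps_n : ∀ n : ℕ, 1 ≤ n → 1 ≤ (n : ℝ) * eps n ^ 2)
    (C₁ C₂ C : ℝ) (hC : C₂ + 2 < C)
    (sieve : ℕ → ℝ → Set (Param dx dy))
    (hA1 : M.TestingCondition θ₀ eps C₁ C sieve)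
    (hA2 : M.PriorMassCondition θ₀ eps C₂ C sieve)
    (hA3 : M.SmoothnessCondition θ₀)
    -- the mean-field variational posterior, as a function of the data
    (q : ∀ n, S n → Measure (Param dx dy))
    (hq : ∀ n : ℕ, 1 ≤ n → ∀ᵐ x ∂(M.dataLaw n θ₀), M.IsVariationalPosterior n x (q n x))
    -- the data, generated under the true parameter
    {Ω : Type*} [MeasurableSpace Ω] (P : Measure Ω) [IsProbabilityMeasure P]
    (data : ∀ n, Ω → S n) (hdata : ∀ n, Measurable (data n))
    (hlaw : ∀ n : ℕ, 1 ≤ n → P.map (data n) = M.dataLaw n θ₀) :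
    ∀ ε : ℝ, 0 < ε →
      ∀ᵐ ω ∂P, Tendsto (fun n => q n (data n ω) {θ | ε < paramDist θ θ₀ ^ 2})
        atTop (𝓝 0) := by

  intro ε hε
  set A : Set (Param dx dy) := {θ | ε < paramDist θ θ₀ ^ 2} with hA_def
  have hA : MeasurableSet A :=
    measurableSet_lt measurable_const ((measurable_paramDist θ₀).pow_const 2)
  have hq_ae : ∀ᵐ ω ∂P, ∀ n, 1 ≤ n → M.IsVariationalPosterior n (data n ω) (q n (data n ω)) := by
    refine ae_all_iff.2 fun n => ?_
    by_cases hn : 1 ≤ n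
    · filter_upwards [ae_of_ae_map (hdata n).aemeasurable (hlaw n hn ▸ hq n hn)] with ω hω _
        using hω
    · exact ae_of_all _ fun ω h => absurd h hn
  -- A one-point parameter set is treated apart, since there the Lipschitz bound does not force `C₄
  -- ≥ 0`, which Markov needs.
  by_cases htriv : ∀ θ ∈ M.paramSet, θ = θ₀
  · filter_upwards [hq_ae] with ω hω
    refine tendsto_const_nhds.congr' ?_
    filter_upwards [eventually_ge_atTop 1] with n hn
    refine (measure_mono_null (fun θ hθ hθm => ?_) (hω n hn).measure_compl_paramSet).symm
    have h0 : ε < paramDist θ θ₀ ^ 2 := hθ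
    rw [htriv θ hθm] at h0
    simp only [paramDist, sub_self, norm_zero] at h0
    norm_num at h0
    linarith
  push Not at htriv
  obtain ⟨θ₁, hθ₁, hne⟩ := htriv
  have hd1 : 0 < paramDist θ₁ θ₀ :=
    (paramDist_nonneg _ _).lt_of_ne fun h => hne (eq_of_paramDist_eq_zero h.symm)
  obtain ⟨hpos, ⟨C₃, hC₃, hlip₃⟩, C₄, hlip₄, hint₄, hlim₄⟩ := hA3
  obtain ⟨c, hc, hthick⟩ := hthick
  have hC0 : 0 < C := by
    have := hA2.nonneg hθ₀ (heps_pos 1 le_rfl)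
    linarith
  -- a separation radius adapted to `ε`
  set e : ℝ := Real.sqrt (ε / (|C₁| + 1)) with he
  have hD : 0 < |C₁| + 1 := by positivity
  have he0 : 0 < e := Real.sqrt_pos.2 (by positivity)
  have he2 : e ^ 2 = ε / (|C₁| + 1) := Real.sq_sqrt (by positivity)
  have hCe : C₁ * e ^ 2 ≤ ε := by
    rw [he2, ← mul_div_assoc, div_le_iff₀ hD]
    nlinarith [le_abs_self C₁]
  set a : ℝ := C * e ^ 2 / 4 with ha_def
  have ha : 0 < a := by positivity
  -- Since `eps n → 0`, the testing and sieve conditions eventually apply at the fixed radius `e`,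
  -- with exponent `C n e² = 4an`.
  have hnum := M.ae_eventually_setLIntegral_lik_le hθ₀ hA ha (by
    filter_upwards [eventually_ge_atTop 1, heps_lim.eventually (eventually_lt_nhds he0)]
      with n hn hne
    obtain ⟨h1, -, φ, h3, h4, h5, h6⟩ := hA1 n hn e hne
    have h7 := hA2.1 n hn e hne
    have h8 : C * n * e ^ 2 = 4 * a * n := by
      rw [ha_def]
      ring
    rw [h8] at h5 h6 h7
    exact ⟨sieve n e, φ, h1, h3, h4, h5, fun θ hθ hθA _ => h6 θ hθ (hCe.trans_lt hθA), h7⟩)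
    hdata hlaw
  have hev := M.ae_eventually_evidence_le hdata hlaw
  have hC4 := BayesModel.ae_eventually_le_pow hint₄ (fun n hn => by
    filter_upwards [hlip₄ n hn] with x hx
    have := (abs_nonneg _).trans (hx.2 θ₁ hθ₁ θ₀ hθ₀)
    exact nonneg_of_mul_nonneg_left this hd1) hlim₄ hdata hlaw
  have hlip_ae : ∀ᵐ ω ∂P, ∀ n, 1 ≤ n → (∀ θ ∈ M.paramSet, 0 < M.lik n θ (data n ω)) ∧
      ∀ θ ∈ M.paramSet, ∀ θ' ∈ M.paramSet,
        |Real.log (M.lik n θ (data n ω)) - Real.log (M.lik n θ' (data n ω))| ≤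
          C₄ n (data n ω) * paramDist θ θ' := by
    refine ae_all_iff.2 fun n => ?_
    by_cases hn : 1 ≤ n
    · filter_upwards [ae_of_ae_map (hdata n).aemeasurable (hlaw n hn ▸ hlip₄ n hn)] with ω hω _
        using hω
    · exact ae_of_all _ fun ω h => absurd h hn
  -- Box points are within `2r ≤ 2` of `θ₀`, so the log-prior drops by at most `2 C₃`; the
  -- log-likelihood drops by at most `n⁴ · 2r = 2` for `r = n⁻⁴`.
  set κ : ℝ := Real.exp (-(2 * C₃)) * M.priorDensity θ₀ * Real.exp (-2) with hκ_def
  have hκ : 0 < κ := mul_pos (mul_pos (Real.exp_pos _) (hpos θ₀ hθ₀)) (Real.exp_pos _)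
  filter_upwards [hq_ae, hnum, hev, hC4, hlip_ae] with ω hω hnum hev hC4 hlip
  have hlim := ENNReal.tendsto_ofReal (tendsto_log_add_exp_div ha (mul_pos hc hκ) (dx + dy))
  rw [ENNReal.ofReal_zero] at hlim
  refine tendsto_of_tendsto_of_tendsto_of_le_of_le' tendsto_const_nhds hlim
    (Eventually.of_forall fun n => zero_le) ?_
  filter_upwards [eventually_ge_atTop 1, hnum, hev, hC4] with n hn hnum hev hC4
  have hn1 : (1 : ℝ) ≤ n := by exact_mod_cast hn
  have hn0 : (0 : ℝ) < n := by linarith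
  set r : ℝ := ((n : ℝ) ^ 4)⁻¹ with hr
  have hr0 : 0 < r := by positivity
  have hr1 : r ≤ 1 := inv_le_one_of_one_le₀ (one_le_pow₀ hn1)
  obtain ⟨Bx, By, hBx, hBy, hmx, hmy, hx, hy, hvol, hdist⟩ := M.exists_box θ₀ r
  have hp : 0 < M.lik n θ₀ (data n ω) := (hlip n hn).1 θ₀ hθ₀
  have hmain := (hω n hn).measure_le hBx hBy hmx hmy hx hy (v := c * r ^ (dx + dy)) (κ := κ)
    (p := M.lik n θ₀ (data n ω)) (E := (n : ℝ) ^ 2) (δ := 2 * Real.exp (-(2 * a * n)))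
    (t := a * n) (by positivity) hκ hp (by positivity) (by positivity) (by positivity)
    ((hthick r hr0 hr1).trans hvol) (fun θ hθ => ?_) hev hA hnum
  · rwa [mul_right_comm c] at hmain
  · have hθm : θ ∈ M.paramSet := Set.prod_mono hBx hBy hθ
    have hdθ := hdist θ hθ
    have h1 := exp_neg_mul_le_of_abs_log_sub_le (t := 2 * C₃) (hpos θ hθm) (hpos θ₀ hθ₀)
      ((hlip₃ θ hθm θ₀ hθ₀).trans (by nlinarith))
    have h2 := exp_neg_mul_le_of_abs_log_sub_le (t := 2) ((hlip n hn).1 θ hθm) hp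
      (((hlip n hn).2 θ hθm θ₀ hθ₀).trans (by
        calc C₄ n (data n ω) * paramDist θ θ₀ ≤ (n : ℝ) ^ 4 * (2 * r) :=
              mul_le_mul hC4 hdθ (paramDist_nonneg _ _) (by positivity)
          _ = 2 := by
              rw [hr]
              field_simp))
    calc κ * M.lik n θ₀ (data n ω) = (Real.exp (-(2 * C₃)) * M.priorDensity θ₀) *
          (Real.exp (-2) * M.lik n θ₀ (data n ω)) := by rw [hκ_def]; ring
      _ ≤ _ := mul_le_mul h1 h2 (by positivity) (hpos θ hθm).le
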